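/- Let $G=(V,E)$ be a finite connected simple graph with $n=|V|\ge 1$ vertices and $m=|E|$ edges, and let $d\ge 1$ be an integer. Let $\mathbb{G}_d\subset\mathbb{C}^*$ be the group of $d$-th roots of unity and $\mathbb{Z}_d=\mathbb{Z}/d\mathbb{Z}$. Let $A_G\in\mathbb{Z}^{n\times m}$ be the (unsigned) incidence matrix of $G$: its entry at $(v,e)\in V\times E$ is $1$ if the vertex $v$ is incident with the edge $e$, and $0$ otherwise. Let $\ker_{\mathbb{Z}_d}(A_G)=\{\mathbf u\in\mathbb{Z}_d^m : A_G\mathbf u\equiv 0 \pmod d\}$, and let $g\ge 0$ be the greatest common divisor of the maximal minors of $A_G$, meaning the $n\times n$ minors (with $g=0$ if there are none, i.e. if $m<n$, or if all of them vanish). For $\mathbf y\in\mathbb{G}_d^m$ and $\mathbf u\in\mathbb{Z}_d^m$ write $\mathbf y^{\mathbf u}=\prod_{e\in E}y_e^{u_e}$, which is well defined because $y_e^d=1$. Let $\mathbf y=(y_e)_{e\in E}\in\mathbb{G}_d^m$. There exists $\mathbf x=(x_v)_{v\in V}\in\mathbb{G}_d^n$ such that $$y_e=x_u x_v\qquad\text{for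 every edge } e=\{u,v\}\in E \tag{$*$}$$ if and only if $\mathbf y^{\mathbf u}=1$ for every $\mathbf u\in\ker_{\mathbb{Z}_d}(A_G)$. Moreover, when this condition holds, the number of solutions $\mathbf x\in\mathbb{G}_d^n$ of $(*)$ is - $d$, if $g=0$; - $2$, if $g=2$ and $d$ is even; - $1$, otherwise. -/

import Mathlib

/-- The incidence matrix `A_G` of `G`, rows indexed by the vertices and columns by the edges:
the entry at `(v, e)` is `1` if `v` is incident with `e`, and `0` if not. -/
def edgeIncMatrix {V : Type*} [DecidableEq V] (G : SimpleGraph V) [DecidableRel G.Adj] :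
    Matrix V G.edgeSet ℤ :=
  (G.incMatrix ℤ).submatrix id (fun e : G.edgeSet => (e : Sym2 V))

/-- The nonnegative gcd of the maximal minors of a matrix `A` with rows indexed by `ι`, that is,
of the determinants of the square submatrices made of all the rows and of `|ι|` distinct columns.
(Every order of the columns occurs, which affects the minors only in their sign.)
It is `0` if there are fewer columns than rows. -/
noncomputable def gcdMaximalMinors {ι κ : Type*} [Fintype ι] [DecidableEq ι] [Fintype κ] [DecidableEq κ]
    (A : Matrix ι κ ℤ) : ℤ :=
  (Finset.univ : Finset (ι ↪ κ)).gcd (fun f => (A.submatrix id f).det)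

/-- `ker_{ℤ_d}(A) = {u ∈ ℤ_d^κ : A u ≡ 0 (mod d)}` for an integer matrix `A`. -/
def modKer {ι κ : Type*} [Fintype κ] (d : ℕ) (A : Matrix ι κ ℤ) :
    Submodule (ZMod d) (κ → ZMod d) :=
  LinearMap.ker (A.map (Int.cast : ℤ → ZMod d)).mulVecLin

/-- The vectors `x` of `d`-th roots of unity, indexed by the vertices of `G`,
such that `y_e = x_u x_v` for every edge `e = {u, v}`. -/
def multSolutions {V : Type*} (G : SimpleGraph V) (d : ℕ) (y : G.edgeSet → rootsOfUnity d ℂ) :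
    Set (V → rootsOfUnity d ℂ) :=
  {x | ∀ (u v : V) (h : G.Adj u v), y ⟨s(u, v), G.mem_edgeSet.mpr h⟩ = x u * x v}

/-! Fix a root `r`. If `a_p` is the alternating edge vector of a walk `p` from `v` to `r`, then `A
a_p = e_v - ε_p e_r`, with `ε_p = ±1` the parity sign. Hence a solution satisfies `x_v = y^{a_p}
x_r^{ε_p}`, and only `x_r` remains to be chosen. With no odd closed walk at `r`, `ε_p` depends on
`v` alone: `x_r` is free, giving `d` solutions, and the signs form a left kernel vector of `A`, so
`g = 0`. An odd closed walk `q₀` at `r` has `A a_{q₀} = 2 e_r`, which forces `x_r² = y^{a_{q₀}}`.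
The kernel condition makes this solvable in the cyclic group, with `gcd(d, 2)` roots; and `g = 2`.
-/

/-! ### Monomials with integer exponents -/

section ZPowVec

variable {κ C : Type*} [Fintype κ] [CommGroup C]

/-- The monomial `y ^ u = ∏ e, y e ^ u e` with an integer exponent vector. -/
def zpowVec (y : κ → C) (u : κ → ℤ) : C := ∏ e, y e ^ u e

theorem zpowVec_sub (y : κ → C) (u w : κ → ℤ) :
    zpowVec y (u - w) = zpowVec y u / zpowVec y w := by
  simp [zpowVec, zpow_sub, div_eq_mul_inv, Finset.prod_mul_distrib]

theorem zpowVec_smul (y : κ → C) (k : ℤ) (u : κ → ℤ) :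
    zpowVec y (k • u) = zpowVec y u ^ k := by
  simp only [zpowVec, Pi.smul_apply, smul_eq_mul, mul_comm k, zpow_mul, Finset.prod_zpow]

theorem zpowVec_single [DecidableEq κ] (y : κ → C) (e : κ) :
    zpowVec y (Pi.single e 1) = y e := by
  rw [zpowVec, Finset.prod_eq_single e]
  · simp
  · intro b _ hb
    simp [hb]
  · simp

theorem zpowVec_prod_zpow {ι : Type*} [Fintype ι] (A : Matrix ι κ ℤ) (x : ι → C) (u : κ → ℤ) :
    zpowVec (fun e => ∏ v, x v ^ A v e) u = ∏ v, x v ^ (A.mulVec u) v := by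
  have hsum : ∀ (a : C) (f : κ → ℤ), a ^ (∑ e, f e) = ∏ e, a ^ f e := fun a f =>
    map_sum (zpowersHom C a).toAdditiveRight f Finset.univ
  simp only [zpowVec, Matrix.mulVec, dotProduct, hsum, ← Finset.prod_zpow, ← zpow_mul]
  exact Finset.prod_comm

theorem zpow_zmod_val {d : ℕ} [NeZero d] {a : C} (ha : a ^ d = 1) (k : ℤ) :
    a ^ (k : ZMod d).val = a ^ k := by
  rw [← zpow_natCast, ZMod.val_intCast]
  conv_rhs => rw [← Int.emod_add_mul_ediv k d, zpow_add, zpow_mul]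
  simp [ha]

theorem zpowVec_eq_one_of_forall_modKer {ι : Type*} {d : ℕ} [NeZero d]
    {A : Matrix ι κ ℤ} {y : κ → C} (hy : ∀ e, y e ^ d = 1)
    (h : ∀ u ∈ modKer d A, ∏ e, y e ^ (u e).val = 1)
    {u : κ → ℤ} (hu : ∀ v, (d : ℤ) ∣ (A.mulVec u) v) : zpowVec y u = 1 := by
  rw [← h (fun e => (u e : ZMod d))]
  · exact Finset.prod_congr rfl fun e _ => (zpow_zmod_val (hy e) _).symm
  · rw [modKer, LinearMap.mem_ker]
    ext v
    have := (ZMod.intCast_zmod_eq_zero_iff_dvd _ d).mpr (hu v)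
    simpa [Matrix.mulVec, dotProduct] using this

end ZPowVec

/-! ### Square roots in finite cyclic groups -/

section Cyclic

variable {C : Type*} [CommGroup C] [IsCyclic C] [Finite C]

/-- If `|C| = 2k` and `a = g ^ n` with `g` a generator, the hypothesis gives `2k ∣ nk`, so `n` is
even. If `|C| = 2k + 1`, the root is `a ^ (k + 1)`. -/
theorem IsCyclic.exists_sq_eq {a : C}
    (h : Even (Nat.card C) → a ^ (Nat.card C / 2) = 1) : ∃ c : C, c ^ 2 = a := by
  rcases Nat.even_or_odd' (Nat.card C) with ⟨k, hk | hk⟩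
  · obtain ⟨g, hg⟩ := IsCyclic.exists_generator (α := C)
    obtain ⟨n, rfl⟩ := Subgroup.mem_zpowers_iff.mp (hg a)
    have h1 := h (by simp [hk])
    have hk0 : (k : ℤ) ≠ 0 := by
      have := Nat.card_pos (α := C)
      omega
    rw [hk, Nat.mul_div_cancel_left _ two_pos, ← zpow_natCast, ← zpow_mul,
      ← orderOf_dvd_iff_zpow_eq_one, orderOf_eq_card_of_forall_mem_zpowers hg, hk] at h1
    push_cast at h1
    obtain ⟨j, rfl⟩ := Int.dvd_of_mul_dvd_mul_right hk0 h1
    exact ⟨g ^ j, by rw [← zpow_natCast, ← zpow_mul, mul_comm]; rfl⟩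
  · refine ⟨a ^ (k + 1), ?_⟩
    rw [← pow_mul, show (k + 1) * 2 = Nat.card C + 1 by omega, pow_succ, pow_card_eq_one', one_mul]

theorem IsCyclic.ncard_sq_eq_one : {c : C | c ^ 2 = 1}.ncard = (Nat.card C).gcd 2 := by
  rw [← IsCyclic.card_powMonoidHom_ker C 2, ← Nat.card_coe_set_eq]
  rfl

end Cyclic

/-! ### The gcd of the maximal minors -/

section Minors

variable {ι κ : Type*} [Fintype ι] [DecidableEq ι] [Fintype κ] [DecidableEq κ]

/-- The Cauchy–Binet expansion: non-injective column choices repeat a column and contribute zero. -/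
theorem gcdMaximalMinors_dvd_det_mul (A : Matrix ι κ ℤ) (W : Matrix κ ι ℤ) :
    gcdMaximalMinors A ∣ (A * W).det := by
  have h : (A * W).det = ∑ f : ι → κ, (∏ i, W (f i) i) * (A.submatrix id f).det := by
    simp only [Matrix.det_apply', Matrix.mul_apply, Finset.prod_univ_sum, Finset.mul_sum,
      Fintype.piFinset_univ]
    rw [Finset.sum_comm]
    refine Finset.sum_congr rfl fun f _ => Finset.sum_congr rfl fun σ _ => ?_
    simp only [Matrix.submatrix_apply, id, Finset.prod_mul_distrib]
    ring
  rw [h]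
  refine Finset.dvd_sum fun f _ => Dvd.dvd.mul_left ?_ _
  by_cases hf : Function.Injective f
  · exact Finset.gcd_dvd (f := fun f : ι ↪ κ => (A.submatrix id f).det)
      (Finset.mem_univ (⟨f, hf⟩ : ι ↪ κ))
  · obtain ⟨i, j, hij, hne⟩ : ∃ i j, f i = f j ∧ i ≠ j := by
      simpa [Function.Injective] using hf
    rw [Matrix.det_zero_of_column_eq hne fun k => by simp [hij]]
    exact dvd_zero _

theorem gcdMaximalMinors_eq_zero_of_vecMul {A : Matrix ι κ ℤ} {w : ι → ℤ} (hw : w ≠ 0)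
    (h : Matrix.vecMul w A = 0) : gcdMaximalMinors A = 0 := by
  refine Finset.gcd_eq_zero_iff.mpr fun f _ => Matrix.exists_vecMul_eq_zero_iff.mp ⟨w, hw, ?_⟩
  ext j
  exact congrFun h (f j)

theorem prime_dvd_gcdMaximalMinors {p : ℕ} [Fact p.Prime] {A : Matrix ι κ ℤ} {w : ι → ℤ}
    {i : ι} (hi : ¬ (p : ℤ) ∣ w i) (h : ∀ e, (p : ℤ) ∣ Matrix.vecMul w A e) :
    (p : ℤ) ∣ gcdMaximalMinors A := by
  refine Finset.dvd_gcd fun f _ => ?_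
  rw [← ZMod.intCast_zmod_eq_zero_iff_dvd, Int.cast_det, ← Matrix.exists_vecMul_eq_zero_iff]
  refine ⟨fun j => (w j : ZMod p), fun h0 => hi ?_, ?_⟩
  · exact (ZMod.intCast_zmod_eq_zero_iff_dvd _ p).mp (congrFun h0 i)
  · ext j
    have := (ZMod.intCast_zmod_eq_zero_iff_dvd _ p).mpr (h (f j))
    simpa [Matrix.vecMul, dotProduct] using this

end Minors

/-! ### Walks and the incidence matrix -/

namespace SimpleGraph

variable {V : Type*} {G : SimpleGraph V}

/-- The sign `(-1) ^ p.length` of a walk. -/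
def Walk.parity {v r : V} (p : G.Walk v r) : ℤ := (-1) ^ p.length

@[simp] theorem Walk.parity_cons {u v r : V} (h : G.Adj u v) (p : G.Walk v r) :
    (Walk.cons h p).parity = -p.parity := by simp [Walk.parity, pow_succ]

theorem Walk.parity_eq_or {v r : V} (p : G.Walk v r) : p.parity = 1 ∨ p.parity = -1 :=
  neg_one_pow_eq_or ℤ _

theorem Walk.parity_eq_neg_one_of_odd {v r : V} {p : G.Walk v r} (h : Odd p.length) :
    p.parity = -1 := h.neg_one_pow

/-- Reversing `p` and then following `q` closes up at `r`. -/
theorem Walk.parity_eq_of_no_odd {v r : V} (h : ∀ q : G.Walk r r, ¬ Odd q.length)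
    (p q : G.Walk v r) : p.parity = q.parity := by
  have h1 := h (p.reverse.append q)
  rw [Walk.length_append, Walk.length_reverse, Nat.not_odd_iff_even, Nat.even_add] at h1
  simp only [Walk.parity, neg_one_pow_eq_ite, h1]

variable [DecidableEq V]

/-- The alternating sum of the edges of a walk, beginning with a plus sign. -/
def Walk.altVec : ∀ {v r : V}, G.Walk v r → G.edgeSet → ℤ
  | _, _, .nil => 0
  | _, _, .cons h p => Pi.single ⟨s(_, _), G.mem_edgeSet.mpr h⟩ 1 - p.altVec

variable [DecidableRel G.Adj]

theorem edgeIncMatrix_apply_adj {u v : V} (h : G.Adj u v) (w : V) :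
    edgeIncMatrix G w ⟨s(u, v), G.mem_edgeSet.mpr h⟩ =
      (if w = u then 1 else 0) + (if w = v then 1 else 0) := by
  have hne := h.ne
  have : s(u, v) ∈ G.incidenceSet w ↔ w = u ∨ w = v := by
    simp [incidenceSet, h]
  simp only [edgeIncMatrix, Matrix.submatrix_apply, id, incMatrix_apply']
  by_cases h1 : w = u <;> by_cases h2 : w = v <;> simp_all

variable [Fintype V]

theorem vecMul_edgeIncMatrix_adj (w : V → ℤ) {u v : V} (h : G.Adj u v) :
    Matrix.vecMul w (edgeIncMatrix G) ⟨s(u, v), G.mem_edgeSet.mpr h⟩ = w u + w v := by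
  simp [Matrix.vecMul, dotProduct, edgeIncMatrix_apply_adj h, mul_add, Finset.sum_add_distrib]

/-- The alternating signs make the interior vertices telescope. -/
theorem edgeIncMatrix_mulVec_altVec {v r : V} (p : G.Walk v r) (w : V) :
    (edgeIncMatrix G).mulVec p.altVec w =
      (if w = v then 1 else 0) - p.parity * (if w = r then 1 else 0) := by
  induction p with
  | nil => simp [Walk.altVec, Walk.parity]
  | cons h p ih =>
    rw [Walk.altVec, Matrix.mulVec_sub, Pi.sub_apply, ih, Matrix.mulVec_single_one,
      Walk.parity_cons]
    simp only [Matrix.col_apply, edgeIncMatrix_apply_adj h]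
    ring

theorem gcdMaximalMinors_edgeIncMatrix_of_no_odd (hG : G.Connected) {r : V}
    (h : ∀ q : G.Walk r r, ¬ Odd q.length) : gcdMaximalMinors (edgeIncMatrix G) = 0 := by
  let P : ∀ v, G.Walk v r := fun v => (hG v r).some
  refine gcdMaximalMinors_eq_zero_of_vecMul (w := fun v => (P v).parity) (fun h0 => ?_) ?_
  · have h1 : (P r).parity = 0 := congrFun h0 r
    rcases (P r).parity_eq_or with h2 | h2 <;> omega
  · ext ⟨e, he⟩
    induction e with
    | h u v =>
      rw [vecMul_edgeIncMatrix_adj _ he, Walk.parity_eq_of_no_odd h (P u) (.cons (G.mem_edgeSet.mp he) (P v)),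
        Walk.parity_cons, neg_add_cancel, Pi.zero_apply]

theorem gcdMaximalMinors_edgeIncMatrix_of_odd (hG : G.Connected) {r : V} {q : G.Walk r r}
    (h : Odd q.length) : gcdMaximalMinors (edgeIncMatrix G) = 2 := by
  have hdvd : ((2 : ℕ) : ℤ) ∣ gcdMaximalMinors (edgeIncMatrix G) := by
    refine prime_dvd_gcdMaximalMinors (w := 1) (i := r) (by norm_num) fun ⟨e, he⟩ => ?_
    induction e with
    | h u v => exact ⟨1, by rw [vecMul_edgeIncMatrix_adj 1 he]; rfl⟩
  -- Choosing `q` itself at `r` makes the `(r, r)` entry of the product below `1 - (-1) = 2`, hence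
  -- its determinant `2`.
  let P : ∀ v, G.Walk v r := fun v => if hv : v = r then q.copy hv.symm rfl else (hG v r).some
  have hPr : (P r).parity = -1 := by
    simpa [P] using Walk.parity_eq_neg_one_of_odd h
  have hM : edgeIncMatrix G * Matrix.of (fun e v => (P v).altVec e) =
      Matrix.updateRow 1 r (fun v => (if r = v then 1 else 0) - (P v).parity) := by
    ext w v
    refine (edgeIncMatrix_mulVec_altVec (P v) w).trans ?_
    rw [Matrix.updateRow_apply]
    split_ifs <;> simp_all [Matrix.one_apply]
  have hdet := gcdMaximalMinors_dvd_det_mul (edgeIncMatrix G)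
    (Matrix.of fun e v => (P v).altVec e)
  rw [hM, ← Matrix.det_transpose, ← Matrix.updateCol_transpose, Matrix.transpose_one,
    ← Matrix.cramer_apply, Matrix.cramer_one] at hdet
  simp only [Module.End.one_apply, hPr] at hdet
  have hnn : 0 ≤ gcdMaximalMinors (edgeIncMatrix G) :=
    Int.nonneg_of_normalize_eq_self Finset.normalize_gcd
  exact Int.dvd_antisymm hnn (by norm_num) (by simpa using hdet) hdvd

end SimpleGraph

/-! ### Counting solutions -/

section Solutions

variable {V C : Type*} [CommGroup C] {G : SimpleGraph V}

/-- The vectors `x` indexed by the vertices of `G`, with entries in a commutative group, such that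
`y_e = x_u x_v` for every edge `e = {u, v}`. -/
def edgeSolutions (G : SimpleGraph V) (y : G.edgeSet → C) : Set (V → C) :=
  {x | ∀ (u v : V) (h : G.Adj u v), y ⟨s(u, v), G.mem_edgeSet.mpr h⟩ = x u * x v}

theorem div_mem_edgeSolutions_one {y : G.edgeSet → C} {x z : V → C}
    (hx : x ∈ edgeSolutions G y) (hz : z ∈ edgeSolutions G y) : z / x ∈ edgeSolutions G 1 := by
  intro u v h
  have h1 := hx u v h
  rw [hz u v h] at h1
  simp only [Pi.one_apply, Pi.div_apply, div_mul_div_comm, h1, div_self']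

theorem mul_mem_edgeSolutions {y : G.edgeSet → C} {x z : V → C}
    (hx : x ∈ edgeSolutions G y) (hz : z ∈ edgeSolutions G 1) : z * x ∈ edgeSolutions G y := by
  intro u v h
  rw [Pi.mul_apply, Pi.mul_apply, mul_mul_mul_comm, ← hz u v h, ← hx u v h, Pi.one_apply, one_mul]

theorem ncard_edgeSolutions_eq {y : G.edgeSet → C} {x : V → C} (hx : x ∈ edgeSolutions G y) :
    (edgeSolutions G y).ncard = (edgeSolutions G (1 : G.edgeSet → C)).ncard := by
  rw [← Set.ncard_image_of_injective (edgeSolutions G 1) (mul_left_injective x)]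
  congr 1
  ext z
  constructor
  · exact fun hz => ⟨z / x, div_mem_edgeSolutions_one hx hz, by simp⟩
  · rintro ⟨w, hw, rfl⟩
    exact mul_mem_edgeSolutions hx hw

theorem eq_zpow_parity_of_mem_edgeSolutions_one {z : V → C} (hz : z ∈ edgeSolutions G 1)
    {v r : V} (p : G.Walk v r) : z v = z r ^ p.parity := by
  induction p with
  | nil => simp [SimpleGraph.Walk.parity]
  | cons h p ih =>
    rw [SimpleGraph.Walk.parity_cons, zpow_neg, ← ih]
    exact eq_inv_of_mul_eq_one_left (hz _ _ h).symm

theorem ncard_edgeSolutions_one_of_no_odd (hG : G.Connected) {r : V}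
    (h : ∀ q : G.Walk r r, ¬ Odd q.length) :
    (edgeSolutions G (1 : G.edgeSet → C)).ncard = Nat.card C := by
  let P : ∀ v, G.Walk v r := fun v => (hG v r).some
  let φ : C → V → C := fun c v => c ^ (P v).parity
  have hPr : (P r).parity = 1 :=
    SimpleGraph.Walk.parity_eq_of_no_odd h (P r) .nil
  have hφ : Function.Injective φ := fun a b hab => by
    simpa [φ, hPr] using congrFun hab r
  rw [← Set.ncard_univ, ← Set.ncard_image_of_injective _ hφ, Set.image_univ]
  congr 1
  ext z
  constructor
  · intro hz
    exact ⟨z r, funext fun v => (eq_zpow_parity_of_mem_edgeSolutions_one hz (P v)).symm⟩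
  · rintro ⟨c, rfl⟩ u v huv
    have := SimpleGraph.Walk.parity_eq_of_no_odd h (P u) (.cons huv (P v))
    simp [φ, this, SimpleGraph.Walk.parity_cons]

/-- The odd walk forces `z r = (z r)⁻¹`, so `z v = (z r) ^ (±1) = z r` and `z` is constant. -/
theorem ncard_edgeSolutions_one_of_odd (hG : G.Connected) {r : V} {q : G.Walk r r}
    (h : Odd q.length) :
    (edgeSolutions G (1 : G.edgeSet → C)).ncard = {c : C | c ^ 2 = 1}.ncard := by
  have hφ : Function.Injective (fun (c : C) (_ : V) => c) := fun a b hab => congrFun hab r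
  rw [← Set.ncard_image_of_injective _ hφ]
  congr 1
  ext z
  constructor
  · intro hz
    have hr := eq_zpow_parity_of_mem_edgeSolutions_one hz q
    rw [SimpleGraph.Walk.parity_eq_neg_one_of_odd h, zpow_neg_one] at hr
    refine ⟨z r, ?_, funext fun v => ?_⟩
    · rw [Set.mem_ofPred_eq, sq]
      exact mul_eq_one_iff_eq_inv.mpr hr
    · obtain ⟨p⟩ := hG v r
      rw [eq_zpow_parity_of_mem_edgeSolutions_one hz p]
      rcases p.parity_eq_or with hp | hp <;> simp [hp, ← hr]
  · rintro ⟨c, hc, rfl⟩ u v _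
    rw [← sq]
    exact hc.symm

end Solutions

/-! ### Existence of solutions -/

section Solvability

variable {V C : Type*} [CommGroup C] [Fintype V] [DecidableEq V] {G : SimpleGraph V}
  [DecidableRel G.Adj]

theorem zpowVec_eq_of_mem_edgeSolutions {y : G.edgeSet → C} {x : V → C}
    (hx : x ∈ edgeSolutions G y) (u : G.edgeSet → ℤ) :
    zpowVec y u = ∏ v, x v ^ ((edgeIncMatrix G).mulVec u) v := by
  rw [← zpowVec_prod_zpow]
  congr 1
  funext ⟨e, he⟩
  induction e with
  | h a b =>
    simp only [SimpleGraph.edgeIncMatrix_apply_adj he, zpow_add, Finset.prod_mul_distrib]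
    simpa using hx a b he

theorem prod_pow_eq_one_of_mem_edgeSolutions {d : ℕ} [NeZero d] (hC : ∀ c : C, c ^ d = 1)
    {y : G.edgeSet → C} {x : V → C} (hx : x ∈ edgeSolutions G y)
    {u : G.edgeSet → ZMod d} (hu : u ∈ modKer d (edgeIncMatrix G)) :
    ∏ e, y e ^ (u e).val = 1 := by
  have h := zpowVec_eq_of_mem_edgeSolutions hx fun e => ((u e).val : ℤ)
  simp only [zpowVec, zpow_natCast] at h
  rw [h]
  refine Finset.prod_eq_one fun v _ => ?_
  obtain ⟨k, hk⟩ : (d : ℤ) ∣ ((edgeIncMatrix G).mulVec fun e => ((u e).val : ℤ)) v := by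
    rw [← ZMod.intCast_zmod_eq_zero_iff_dvd]
    rw [modKer, LinearMap.mem_ker] at hu
    simpa [Matrix.mulVec, dotProduct] using congrFun hu v
  rw [hk, zpow_mul, zpow_natCast, hC, one_zpow]

theorem exists_mem_edgeSolutions [IsCyclic C] [Finite C] (hG : G.Connected) {y : G.edgeSet → C}
    (hy : ∀ u : G.edgeSet → ℤ,
      (∀ v, (Nat.card C : ℤ) ∣ ((edgeIncMatrix G).mulVec u) v) → zpowVec y u = 1) :
    ∃ x, x ∈ edgeSolutions G y := by
  obtain ⟨r⟩ := hG.nonempty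
  -- With `c` as the value at `r`, path independence suffices: compare the walk chosen at `u` with
  -- the edge `uv` followed by the walk chosen at `v`.
  suffices h : ∃ c : C, ∀ (v : V) (p q : G.Walk v r),
      zpowVec y p.altVec * c ^ p.parity = zpowVec y q.altVec * c ^ q.parity by
    obtain ⟨c, hc⟩ := h
    let P : ∀ v, G.Walk v r := fun v => (hG v r).some
    refine ⟨fun v => zpowVec y (P v).altVec * c ^ (P v).parity, fun u v huv => ?_⟩
    dsimp only
    rw [hc u (P u) (.cons huv (P v)), SimpleGraph.Walk.parity_cons, SimpleGraph.Walk.altVec,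
      zpowVec_sub, zpowVec_single, zpow_neg]
    simp [div_eq_mul_inv, mul_assoc, mul_comm, mul_left_comm]
  by_cases hodd : ∃ q : G.Walk r r, Odd q.length
  · obtain ⟨q₀, hq₀⟩ := hodd
    have hs := SimpleGraph.Walk.parity_eq_neg_one_of_odd hq₀
    obtain ⟨c, hc⟩ : ∃ c : C, c ^ 2 = zpowVec y q₀.altVec := by
      refine IsCyclic.exists_sq_eq fun ⟨k, hk⟩ => ?_
      -- For `|C|` even, `(|C|/2) a_{q₀}` lies in the kernel mod `|C|`, since `A a_{q₀} = 2 e_r`.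
      rw [← zpow_natCast, ← zpowVec_smul]
      refine hy _ fun v => ?_
      rw [Matrix.mulVec_smul, Pi.smul_apply, SimpleGraph.edgeIncMatrix_mulVec_altVec, hs, hk,
        ← two_mul, Nat.mul_div_cancel_left _ two_pos]
      exact ⟨if v = r then 1 else 0, by push_cast; simp only [smul_eq_mul]; ring⟩
    refine ⟨c, fun v p q => ?_⟩
    obtain ⟨k, hk⟩ : ∃ k, p.parity - q.parity = 2 * k := by
      rcases p.parity_eq_or with hp | hp <;> rcases q.parity_eq_or with hq | hq <;> rw [hp, hq]
      exacts [⟨0, rfl⟩, ⟨1, rfl⟩, ⟨-1, rfl⟩, ⟨0, rfl⟩]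
    -- `A (a_q - a_p) = (ε_p - ε_q) e_r = 2k e_r`, which `k a_{q₀}` cancels over the integers.
    have h1 := hy (q.altVec - p.altVec - k • q₀.altVec) fun v => by
      simp only [Matrix.mulVec_sub, Matrix.mulVec_smul, Pi.sub_apply, Pi.smul_apply, smul_eq_mul,
        SimpleGraph.edgeIncMatrix_mulVec_altVec, hs]
      refine (dvd_zero _).trans (dvd_of_eq ?_)
      linear_combination (-(if v = r then (1 : ℤ) else 0)) * hk
    rw [zpowVec_sub, zpowVec_sub, zpowVec_smul, ← hc, div_eq_one, div_eq_iff_eq_mul] at h1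
    rw [h1, ← zpow_natCast, ← zpow_mul, Nat.cast_ofNat, ← hk, zpow_sub]
    simp [mul_assoc, mul_comm, mul_left_comm]
  · push Not at hodd
    refine ⟨1, fun v p q => ?_⟩
    have h1 := hy (q.altVec - p.altVec) fun v => by
      rw [Matrix.mulVec_sub, Pi.sub_apply, SimpleGraph.edgeIncMatrix_mulVec_altVec,
        SimpleGraph.edgeIncMatrix_mulVec_altVec,
        SimpleGraph.Walk.parity_eq_of_no_odd (fun q => hodd q) p q, sub_self]
      exact dvd_zero _
    rw [zpowVec_sub, div_eq_one] at h1
    rw [h1, one_zpow, one_zpow]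

end Solvability

theorem theorem6p1 {V : Type*} [Fintype V] [DecidableEq V] (G : SimpleGraph V)
    [DecidableRel G.Adj] (hG : G.Connected) (d : ℕ) (hd : 1 ≤ d)
    (y : G.edgeSet → rootsOfUnity d ℂ) :
    ((∃ x : V → rootsOfUnity d ℂ, x ∈ multSolutions G d y) ↔
      ∀ u ∈ modKer d (edgeIncMatrix G), ∏ e : G.edgeSet, y e ^ (u e).val = 1) ∧
    ((∀ u ∈ modKer d (edgeIncMatrix G), ∏ e : G.edgeSet, y e ^ (u e).val = 1) →
      (gcdMaximalMinors (edgeIncMatrix G) = 0 → (multSolutions G d y).ncard = d) ∧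
      (gcdMaximalMinors (edgeIncMatrix G) = 2 ∧ Even d → (multSolutions G d y).ncard = 2) ∧
      (¬ gcdMaximalMinors (edgeIncMatrix G) = 0 ∧
        ¬ (gcdMaximalMinors (edgeIncMatrix G) = 2 ∧ Even d) →
          (multSolutions G d y).ncard = 1)) := by
  have : NeZero d := ⟨by omega⟩
  have hcard : Nat.card (rootsOfUnity d ℂ) = d := Complex.card_rootsOfUnity d
  have hpow : ∀ c : rootsOfUnity d ℂ, c ^ d = 1 := fun c =>
    orderOf_dvd_iff_pow_eq_one.mp ((orderOf_dvd_natCard c).trans (dvd_of_eq hcard))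
  have hS : multSolutions G d y = edgeSolutions G y := rfl
  have hex : (∀ u ∈ modKer d (edgeIncMatrix G), ∏ e : G.edgeSet, y e ^ (u e).val = 1) →
      ∃ x, x ∈ edgeSolutions G y := fun h =>
    exists_mem_edgeSolutions hG fun u hu =>
      zpowVec_eq_one_of_forall_modKer (fun e => hpow (y e)) h (hcard ▸ hu)
  rw [hS]
  refine ⟨⟨fun ⟨x, hx⟩ u hu => prod_pow_eq_one_of_mem_edgeSolutions hpow hx hu, hex⟩,
    fun h => ?_⟩
  obtain ⟨x, hx⟩ := hex h
  rw [ncard_edgeSolutions_eq hx]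
  obtain ⟨r⟩ := hG.nonempty
  by_cases hodd : ∃ q : G.Walk r r, Odd q.length
  · obtain ⟨q, hq⟩ := hodd
    rw [SimpleGraph.gcdMaximalMinors_edgeIncMatrix_of_odd hG hq,
      ncard_edgeSolutions_one_of_odd hG hq, IsCyclic.ncard_sq_eq_one, hcard]
    refine ⟨fun h0 => absurd h0 two_ne_zero, fun ⟨_, hev⟩ => ?_, fun ⟨_, hne⟩ => ?_⟩
    · exact Nat.gcd_eq_right hev.two_dvd
    · exact Nat.coprime_two_right.mpr (Nat.not_even_iff_odd.mp fun hev => hne ⟨rfl, hev⟩)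
  · push Not at hodd
    rw [SimpleGraph.gcdMaximalMinors_edgeIncMatrix_of_no_odd hG fun q => hodd q,
      ncard_edgeSolutions_one_of_no_odd hG fun q => hodd q, hcard]
    exact ⟨fun _ => rfl, fun ⟨h2, _⟩ => absurd h2 (by norm_num), fun ⟨h0, _⟩ => absurd rfl h0⟩
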